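/- **Definitions.** An ideal on a set $X$ is a family $\mathcal I\subseteq\mathcal P(X)$ with $\emptyset\in\mathcal I$ and $X\notin\mathcal I$ that is closed under subsets and finite unions; $\mathcal I^+=\mathcal P(X)\setminus\mathcal I$, and for $A\in\mathcal I^+$, $\mathcal I\upharpoonright A=\mathcal P(A)\cap\mathcal I$ is an ideal on $A$, with dual filter $(\mathcal I\upharpoonright A)^*=\{A\setminus N: N\in\mathcal I\upharpoonright A\}$. For ideals $\mathcal J$ on $Y$ and $\mathcal I$ on $X$, $\mathcal J\le_{K}\mathcal I$ (Katětov order) means that there is $f:X\to Y$ with $f^{-1}[A]\in\mathcal I$ for all $A\in\mathcal J$. For a topological space $X$, $\mathsf{nwd}(X)$ is the ideal of its nowhere dense subsets, and $\mathsf{nwd}=\mathsf{nwd}(\mathbb Q)$. $\mathcal{ED}$ is the ideal on $\omega\times\omega$ generated by the columns $\{n\}\times\omega$ and the graphs of functions $\omega\to\omega$. An ideal $\mathcal I$ satisfies the Category Dichotomy if $\mathcal I\le_K\mathsf{nwd}$ or there is $A\in\mathcal I^+$ with $\mathcal{ED}\le_K\mathcal I\upharpoonright A$. The ideal $\mathcal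 I$ is * tight if for all $X_n\in\mathcal I^+$ $(n\in\omega)$ there is $Y\in\mathcal I$ such that $Y\cap X_n$ is infinite for every $n$; * $P^-$ if for every $A\in\mathcal I^+$ and all $X_n\in(\mathcal I\upharpoonright A)^*$ $(n\in\omega)$ there is $Y\in\mathcal I^+$ such that $Y\setminus X_n$ is finite for every $n$; * $Q^+$ if for every $A\in\mathcal I^+$ and every partition $\{P_n : n\in\omega\}$ of $A$ into finite sets there is $Y\in\mathcal I^+$, $Y\subseteq A$, with $|Y\cap P_n|\le 1$ for every $n$. An independent family is an infinite family $\mathcal B$ of infinite subsets of $\omega$ such that for every finite partial function $p:\mathcal B\to 2$ the set $B^p=\bigcap_{A\in\mathrm{dom}(p)}A^{p(A)}$ is infinite, where $A^0=A$, $A^1=\omega\setminus A$; it separates points if for all distinct $m,n\in\omega$ there is $B\in\mathcal B$ with $m\in B$, $n\notin B$. The space $X(\mathcal B)$ is $\omega$ with the topology that has the sets $B^p$ as a base. $\mathrm{cov}(\mathcal M)$ is the least size of a family of meager sets covering $\omega^\omega$. **Theorem.** Assume $\omega_1<\mathrm{cov}(\mathcal M)$. Then there is an independent family $\mathcal B$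 that separates points, of size $\omega_1$, such that $\mathsf{nwd}(X(\mathcal B))$ does not satisfy the Category Dichotomy. Moreover, for every independent family $\mathcal B$ of size $\omega_1$ that separates points, the ideal $\mathsf{nwd}(X(\mathcal B))$ is tight, $\mathsf{nwd}(X(\mathcal B))\not\le_K\mathsf{nwd}$, it is both $P^-$ and $Q^+$, and $\mathcal{ED}\not\le_K\mathsf{nwd}(X(\mathcal B))\upharpoonright Y$ for every $Y\in\mathsf{nwd}(X(\mathcal B))^+$. -/

import Mathlib

open Cardinal

namespace CategoryDichotomy

/-! ## Ideals on sets

An ideal of sets on `X` is a Mathlib order ideal of the lattice `Set X`. The ideals that occur below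
are proper, which is proved where they are introduced. -/

/-- The ideal `nwd(X, τ)` of nowhere dense subsets of a topological space. -/
def nwd {X : Type*} (τ : TopologicalSpace X) : Order.Ideal (Set X) where
  carrier := {A | @IsNowhereDense X τ A}
  lower' := fun _ _ hBA hA => hA.mono hBA
  nonempty' := ⟨∅, isNowhereDense_empty⟩
  directed' := fun A hA B hB => by
    refine ⟨A ∪ B, ?_, Set.subset_union_left, Set.subset_union_right⟩
    have hA' : interior (closure A) = ∅ := hA
    have hB' : interior (closure B) = ∅ := hB
    show interior (closure (A ∪ B)) = ∅
    rw [closure_union, interior_union_isClosed_of_interior_empty isClosed_closure hB', hA']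

theorem mem_nwd {X : Type*} {τ : TopologicalSpace X} {A : Set X} :
    A ∈ nwd τ ↔ @IsNowhereDense X τ A := Iff.rfl

theorem nwd_isProper {X : Type*} [Nonempty X] (τ : TopologicalSpace X) : (nwd τ).IsProper := by
  refine Order.Ideal.isProper_of_notMem (p := Set.univ) fun h => ?_
  have h' : interior (closure (Set.univ : Set X)) = ∅ := h
  simp at h'

/-- The ideal `nwd` of nowhere dense subsets of the rationals with their usual topology. -/
def nwdRat : Order.Ideal (Set ℚ) := nwd (inferInstance : TopologicalSpace ℚ)

/-- The ideal `ED` on `ω × ω` generated by the columns `{n} × ω` and the graphs of functions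
from `ω` to `ω`. -/
def ED : Order.Ideal (Set (ℕ × ℕ)) where
  carrier := {A | ∃ (F : Finset ℕ) (G : Set (ℕ → ℕ)), G.Finite ∧
    A ⊆ {x | x.1 ∈ F ∨ ∃ g ∈ G, g x.1 = x.2}}
  lower' := fun _ _ hBA ⟨F, G, hG, h⟩ => ⟨F, G, hG, Set.Subset.trans hBA h⟩
  nonempty' := ⟨∅, ∅, ∅, Set.finite_empty, Set.empty_subset _⟩
  directed' := by
    rintro A ⟨F, G, hG, hA⟩ B ⟨F', G', hG', hB⟩
    refine ⟨A ∪ B, ⟨F ∪ F', G ∪ G', hG.union hG', ?_⟩,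
      Set.subset_union_left, Set.subset_union_right⟩
    rintro x (hx | hx)
    · rcases hA hx with h | ⟨g, hg, h⟩
      · exact Or.inl (Finset.mem_union_left _ h)
      · exact Or.inr ⟨g, Or.inl hg, h⟩
    · rcases hB hx with h | ⟨g, hg, h⟩
      · exact Or.inl (Finset.mem_union_right _ h)
      · exact Or.inr ⟨g, Or.inr hg, h⟩

theorem ED_isProper : ED.IsProper := by
  refine Order.Ideal.isProper_of_notMem (p := Set.univ) ?_
  rintro ⟨F, G, hG, h⟩
  obtain ⟨n, hn⟩ := Infinite.exists_notMem_finset F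
  have hfin : ((fun g : ℕ → ℕ => g n) '' G).Finite := hG.image _
  obtain ⟨m, hm⟩ := hfin.exists_notMem
  rcases h (Set.mem_univ (n, m)) with h | ⟨g, hg, h⟩
  · exact hn h
  · exact hm ⟨g, hg, h⟩

/-- The restriction of `I` to `A`, as an ideal on the set `A`. -/
def restrict {X : Type*} (I : Order.Ideal (Set X)) (A : Set X) : Order.Ideal (Set A) where
  carrier := {B | Subtype.val '' B ∈ I}
  lower' := fun _ _ hBA hA => I.lower (Set.image_mono hBA) hA
  nonempty' := ⟨∅, by
    show Subtype.val '' (∅ : Set A) ∈ I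
    rw [Set.image_empty]; exact I.bot_mem⟩
  directed' := fun B hB C hC =>
    ⟨B ∪ C, by
      show Subtype.val '' (B ∪ C) ∈ I
      rw [Set.image_union]; exact I.sup_mem hB hC,
      Set.subset_union_left, Set.subset_union_right⟩

theorem restrict_isProper {X : Type*} {I : Order.Ideal (Set X)} {A : Set X} (hA : A ∉ I) :
    (restrict I A).IsProper := by
  refine Order.Ideal.isProper_of_notMem (p := Set.univ) fun h => hA ?_
  have h' : Subtype.val '' (Set.univ : Set A) ∈ I := h
  simpa using h'

/-- The Katětov order: `KatetovLE J I` is `J ≤_K I`, that is, there is a function `f : X → Y`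
such that preimages of sets in `J` are in `I`. -/
def KatetovLE {X Y : Type*} (J : Order.Ideal (Set Y)) (I : Order.Ideal (Set X)) : Prop :=
  ∃ f : X → Y, ∀ A : Set Y, A ∈ J → f ⁻¹' A ∈ I

/-- `I` satisfies the Category Dichotomy: it is Katětov below `nwd`, or one of its restrictions to
a positive set is Katětov above `ED`. -/
def SatisfiesCategoryDichotomy {X : Type*} (I : Order.Ideal (Set X)) : Prop :=
  KatetovLE I nwdRat ∨ ∃ A : Set X, A ∉ I ∧ KatetovLE ED (restrict I A)

/-- `I` is tight. -/
def IsTight {X : Type*} (I : Order.Ideal (Set X)) : Prop :=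
  ∀ S : ℕ → Set X, (∀ n, S n ∉ I) → ∃ Y ∈ I, ∀ n, (Y ∩ S n).Infinite

/-- `I` is a `P⁻`-ideal. The conditions `S n ⊆ A` and `A \ S n ∈ I` say that `S n` belongs to the
dual filter of the restriction of `I` to `A`. -/
def IsPMinus {X : Type*} (I : Order.Ideal (Set X)) : Prop :=
  ∀ A : Set X, A ∉ I → ∀ S : ℕ → Set X, (∀ n, S n ⊆ A ∧ A \ S n ∈ I) →
    ∃ Y : Set X, Y ∉ I ∧ ∀ n, (Y \ S n).Finite

/-- `I` is a `Q⁺`-ideal. -/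
def IsQPlus {X : Type*} (I : Order.Ideal (Set X)) : Prop :=
  ∀ A : Set X, A ∉ I → ∀ P : ℕ → Set X, (∀ n, (P n).Finite) →
    Pairwise (fun m n => Disjoint (P m) (P n)) → ⋃ n, P n = A →
    ∃ Y : Set X, Y ∉ I ∧ Y ⊆ A ∧ ∀ n, (Y ∩ P n).Subsingleton

/-! ## Independent families and their spaces -/

/-- `A^0 = A` and `A^1 = ω \ A`. -/
def side (A : Set ℕ) (i : Fin 2) : Set ℕ := if i = 0 then A else Aᶜ

/-- The set `B^p = ⋂_{A ∈ dom p} A^{p(A)}`, for the finite partial function with domain `s` given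
by the restriction of `p` to `s`; it is `ω` if the domain is empty. -/
def cell (s : Finset (Set ℕ)) (p : Set ℕ → Fin 2) : Set ℕ := ⋂ A ∈ s, side A (p A)

/-- `B` is an independent family: an infinite family of infinite subsets of `ω` all of whose
finite Boolean combinations `B^p` are infinite. -/
def IsIndependentFamily (B : Set (Set ℕ)) : Prop :=
  B.Infinite ∧ (∀ A ∈ B, A.Infinite) ∧
    ∀ (s : Finset (Set ℕ)) (p : Set ℕ → Fin 2), (s : Set (Set ℕ)) ⊆ B → (cell s p).Infinite

/-- `B` separates points. -/
def SeparatesPoints (B : Set (Set ℕ)) : Prop :=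
  ∀ m n : ℕ, m ≠ n → ∃ A ∈ B, m ∈ A ∧ n ∉ A

/-- The envelope of `B`: the family of all `B^p`. -/
def envelope (B : Set (Set ℕ)) : Set (Set ℕ) :=
  {U | ∃ (s : Finset (Set ℕ)) (p : Set ℕ → Fin 2), (s : Set (Set ℕ)) ⊆ B ∧ U = cell s p}

/-- The topology of the space `X(B)`, whose underlying set is `ω`. -/
abbrev indepTopology (B : Set (Set ℕ)) : TopologicalSpace ℕ :=
  TopologicalSpace.generateFrom (envelope B)

theorem mem_cell {s : Finset (Set ℕ)} {p : Set ℕ → Fin 2} {x : ℕ} :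
    x ∈ cell s p ↔ ∀ A ∈ s, x ∈ side A (p A) := by
  simp [cell]

/-- The envelope is a base of the topology of `X(B)`. -/
theorem isTopologicalBasis_envelope (B : Set (Set ℕ)) :
    @TopologicalSpace.IsTopologicalBasis ℕ (indepTopology B) (envelope B) := by
  classical
  refine @TopologicalSpace.IsTopologicalBasis.mk ℕ (indepTopology B) _ ?_ ?_ rfl
  · rintro _ ⟨s, p, hs, rfl⟩ _ ⟨t, q, ht, rfl⟩ x ⟨hx, hx'⟩
    rw [mem_cell] at hx hx'
    refine ⟨_, ⟨s ∪ t, fun A => if A ∈ s then p A else q A, ?_, rfl⟩, ?_, ?_⟩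
    · rw [Finset.coe_union]; exact Set.union_subset hs ht
    · rw [mem_cell]
      intro A hA
      by_cases h : A ∈ s
      · simpa [h] using hx A h
      · simpa [h] using hx' A ((Finset.mem_union.1 hA).resolve_left h)
    · intro y hy
      rw [mem_cell] at hy
      have h1 : ∀ A ∈ s, y ∈ side A (p A) := fun A hA => by
        simpa [hA] using hy A (Finset.mem_union_left _ hA)
      refine ⟨mem_cell.2 h1, mem_cell.2 fun A hA => ?_⟩
      by_cases h : A ∈ s
      · have e : p A = q A := by
          have h2 := hx A h
          have h3 := hx' A hA
          unfold side at h2 h3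
          split_ifs at h2 h3 with a b b
          · rw [a, b]
          · exact absurd h2 h3
          · exact absurd h3 h2
          · omega
        rw [← e]; exact h1 A h
      · simpa [h] using hy A (Finset.mem_union_right _ hA)
  · refine Set.eq_univ_of_forall fun x => ⟨_, ⟨∅, fun _ => 0, by simp, rfl⟩, ?_⟩
    rw [mem_cell]; simp

/-! ## The covering number of the meager ideal -/

/-- `cov(M)`: the least size of a family of meager sets that covers the Baire space `ω^ω`. -/
noncomputable def covM : Cardinal.{0} :=
  sInf {κ | ∃ S : Set (Set (ℕ → ℕ)), (∀ A ∈ S, IsMeagre A) ∧ ⋃₀ S = Set.univ ∧ #S = κ}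

end CategoryDichotomy

namespace CategoryDichotomy

/-! ## Meeting few dense sets -/

/-! The Category Dichotomy fails for `nwd(X(B))` because both of its alternatives do, for unrelated
reasons.

The first fails by tightness, which needs only that `B` is uncountable
(`isTight_nwd_indepTopology`). Countably many positive sets are dense in basic cells whose supports
use countably many members of `B`; infinitely many members `C i` remain. One can choose points of
the positive sets that eventually enter every `C i`, and such a set of points is nowhere dense. A
tight ideal is not Katětov below `nwd`, as the images of a countable base of `ℚ` are positive.

The second fails because the space has a base of size `ℵ₁ < cov(M)`. A set meeting every nonempty
basic subset of some basic open set is positive, so positivity amounts to at most `ℵ₁` requirements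
on a function, all met at once by `exists_forall_meets`. The same argument gives `P⁻` and `Q⁺`.

A suitable `B` exists outright: view points of `ω` as clopen subsets of the Cantor space, and
members of `B` as points of that space. -/

/-- Fewer than `cov(M)` many requirements of the form "`f` passes through a point of `E i`", each
of them satisfiable arbitrarily far out, can be met by a single function. -/
theorem exists_forall_meets {ι : Type} {κ : Cardinal} (h : κ < covM) (hι : #ι ≤ κ)
    (E : ι → Set (ℕ × ℕ)) (hE : ∀ i k, ∃ e ∈ E i, k ≤ e.1) :
    ∃ f : ℕ → ℕ, ∀ i, ∃ e ∈ E i, f e.1 = e.2 := by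
  by_contra! hcon
  let M : ι → Set (ℕ → ℕ) := fun i => {f | ∀ e ∈ E i, f e.1 ≠ e.2}
  have hclosed : ∀ i, IsClosed (M i) := fun i => by
    have : M i = ⋂ e ∈ E i, {f | f e.1 ≠ e.2} := by ext f; simp [M]
    rw [this]
    refine isClosed_biInter fun e _ => ?_
    exact (isClosed_discrete {n : ℕ | n ≠ e.2}).preimage
      (continuous_apply (A := fun _ : ℕ => ℕ) e.1)
  have hdense : ∀ i, Dense (M i)ᶜ := fun i f => by
    choose e he hk using hE i
    -- Changing `f` at one coordinate `≥ k` puts it outside `M i`, and these modifications converge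
    -- to `f`.
    have ht : Filter.Tendsto (fun k => Function.update f (e k).1 (e k).2) Filter.atTop (nhds f) := by
      refine tendsto_pi_nhds.2 fun n => tendsto_const_nhds.congr' ?_
      filter_upwards [Filter.eventually_gt_atTop n] with k hn
      rw [Function.update_of_ne (by have := hk k; omega)]
    refine mem_closure_of_tendsto ht (Filter.Eventually.of_forall fun k hmem => ?_)
    exact hmem (e k) (he k) (Function.update_self _ _ _)
  have hmeagre : ∀ i, IsMeagre (M i) := fun i =>
    residual_of_dense_open (hclosed i).isOpen_compl (hdense i)
  have hle : covM ≤ #(Set.range M) := csInf_le' ⟨Set.range M, by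
    rintro _ ⟨i, rfl⟩; exact hmeagre i, by
    refine Set.eq_univ_of_forall fun f => ?_
    obtain ⟨i, hi⟩ := hcon f
    exact ⟨_, ⟨i, rfl⟩, hi⟩, rfl⟩
  exact (hle.trans (mk_range_le.trans hι)).not_gt h

/-- The variant of `exists_forall_meets` for partial functions into a countable type. -/
theorem exists_partial_forall_meets {ι X : Type} [Countable X] {κ : Cardinal} (h : κ < covM)
    (hι : #ι ≤ κ) (E : ι → Set (ℕ × X)) (hE : ∀ i k, ∃ e ∈ E i, k ≤ e.1) :
    ∃ R : ℕ → Set X, (∀ n, (R n).Subsingleton) ∧ ∀ i, ∃ e ∈ E i, e.2 ∈ R e.1 := by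
  obtain ⟨c, hc⟩ := exists_injective_nat X
  obtain ⟨f, hf⟩ := exists_forall_meets h hι (fun i => Prod.map id c '' E i) fun i k => by
    obtain ⟨e, he, hk⟩ := hE i k
    exact ⟨_, ⟨e, he, rfl⟩, hk⟩
  refine ⟨fun n => {x | f n = c x}, fun n x hx y hy => hc (hx.symm.trans hy), fun i => ?_⟩
  obtain ⟨_, ⟨e, he, rfl⟩, hfe⟩ := hf i
  exact ⟨e, he, hfe⟩

/-! ## Nowhere dense sets in countable spaces with a small base -/

theorem diff_nonempty_of_notMem {X : Type*} {I : Order.Ideal (Set X)} {A N : Set X} (hA : A ∉ I)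
    (hN : N ∈ I) : (A \ N).Nonempty := by
  by_contra hcon
  exact hA (I.lower (Set.sdiff_eq_empty.1 (Set.not_nonempty_iff_eq_empty.1 hcon)) hN)

theorem biUnion_lt_mem {X : Type*} {I : Order.Ideal (Set X)} {N : ℕ → Set X} (hN : ∀ n, N n ∈ I) (k : ℕ) :
    ⋃ n < k, N n ∈ I := by
  induction k with
  | zero => simpa using I.bot_mem
  | succ k ih =>
    rw [Set.biUnion_lt_succ]
    exact I.sup_mem ih (hN k)

section Topology

variable {X : Type} [τ : TopologicalSpace X]

theorem exists_mem_basis_of_notMem_nwd {E : Set (Set X)}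
    (hE : TopologicalSpace.IsTopologicalBasis E) {Y : Set X} (hY : Y ∉ nwd τ) :
    ∃ U ∈ E, U.Nonempty ∧ U ⊆ closure Y := by
  have hne : (interior (closure Y)).Nonempty := Set.nonempty_iff_ne_empty.2 hY
  obtain ⟨x, hx⟩ := hne
  obtain ⟨U, hU, hxU, hsub⟩ := hE.exists_subset_of_mem_open hx isOpen_interior
  exact ⟨U, hU, ⟨x, hxU⟩, hsub.trans interior_subset⟩

theorem notMem_nwd_of_subset_closure {U Y : Set X} (hU : IsOpen U) (hne : U.Nonempty)
    (h : U ⊆ closure Y) : Y ∉ nwd τ := fun hY => by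
  have hY' : interior (closure Y) = ∅ := hY
  obtain ⟨x, hx⟩ := hne
  have : x ∈ interior (closure Y) := interior_maximal h hU hx
  rw [hY'] at this
  exact this

theorem notMem_nwd_of_forall_inter_nonempty {E : Set (Set X)}
    (hE : TopologicalSpace.IsTopologicalBasis E) {U Y : Set X} (hU : U ∈ E) (hne : U.Nonempty)
    (h : ∀ V ∈ E, V ⊆ U → V.Nonempty → (Y ∩ V).Nonempty) : Y ∉ nwd τ := by
  refine notMem_nwd_of_subset_closure (hE.isOpen hU) hne fun x hx => ?_
  refine mem_closure_iff.2 fun O hO hxO => ?_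
  obtain ⟨V, hV, hxV, hsub⟩ := hE.exists_subset_of_mem_open (⟨hxO, hx⟩ : x ∈ O ∩ U)
    (hO.inter (hE.isOpen hU))
  obtain ⟨y, hyY, hyV⟩ := h V hV (hsub.trans Set.inter_subset_right) ⟨x, hxV⟩
  exact ⟨y, (hsub hyV).1, hyY⟩

theorem inter_notMem_nwd {U V Y : Set X} (hU : U ⊆ closure Y) (hV : IsOpen V) (hVU : V ⊆ U)
    (hne : V.Nonempty) : Y ∩ V ∉ nwd τ := by
  refine notMem_nwd_of_subset_closure hV hne fun x hx => ?_
  have := hV.inter_closure (t := Y) ⟨hx, hU (hVU hx)⟩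
  rwa [Set.inter_comm] at this

theorem finite_mem_nwd [T1Space X] (hX : ∀ U : Set X, IsOpen U → U.Nonempty → U.Infinite)
    {F : Set X} (hF : F.Finite) : F ∈ nwd τ := by
  show interior (closure F) = ∅
  rw [hF.isClosed.closure_eq]
  by_contra hne
  exact hX _ isOpen_interior (Set.nonempty_iff_ne_empty.2 hne) (hF.subset interior_subset)

variable {E : Set (Set X)} (hE : TopologicalSpace.IsTopologicalBasis E) {κ : Cardinal.{0}}
  (hκ : κ < covM) (hEκ : #E ≤ κ)

include hE hκ hEκ

/-- The requirement for `V` is a point of `V` placed at some coordinate `n` and lying in `S i` for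
all `i < n`. It can be met arbitrarily far out, since a positive set is not covered by finitely many
sets from the ideal. At most one point is kept per coordinate, which bounds what lies outside `S n`.
-/
theorem isPMinus_nwd [Countable X] : IsPMinus (nwd τ) := by
  intro A hA S hS
  obtain ⟨U, hUE, hUne, hU⟩ := exists_mem_basis_of_notMem_nwd hE hA
  obtain ⟨R, hR, hmeet⟩ := exists_partial_forall_meets (X := X)
    (ι := {V : E // V.1 ⊆ U ∧ V.1.Nonempty}) hκ ((mk_subtype_le _).trans hEκ)
    (fun V => {e | e.2 ∈ V.1.1 ∧ ∀ i < e.1, e.2 ∈ S i}) fun V k => by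
      obtain ⟨x, hx, hxN⟩ := diff_nonempty_of_notMem
        (inter_notMem_nwd hU (hE.isOpen V.1.2) V.2.1 V.2.2) (biUnion_lt_mem (fun n => (hS n).2) k)
      refine ⟨(k, x), ⟨hx.2, fun i hi => ?_⟩, le_rfl⟩
      by_contra hxi
      exact hxN (Set.mem_biUnion (show i ∈ {i | i < k} from hi) ⟨hx.1, hxi⟩)
  refine ⟨{x | ∃ n, x ∈ R n ∧ ∀ i < n, x ∈ S i}, ?_, fun n => ?_⟩
  · refine notMem_nwd_of_forall_inter_nonempty hE hUE hUne fun V hV hVU hne => ?_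
    obtain ⟨e, ⟨heV, heS⟩, heR⟩ := hmeet ⟨⟨V, hV⟩, hVU, hne⟩
    exact ⟨e.2, ⟨e.1, heR, heS⟩, heV⟩
  · refine ((Set.finite_Iic n).biUnion fun m _ => (hR m).finite).subset ?_
    rintro x ⟨⟨m, hxm, hxS⟩, hxn⟩
    exact Set.mem_biUnion (show m ∈ Set.Iic n from not_lt.1 fun hlt => hxn (hxS n hlt)) hxm

/-- Here coordinate `n` may only receive a point of `P n`. Finite sets are nowhere dense, so every
nonempty basic `V ⊆ U` contains points of pieces with arbitrarily large index. -/
theorem isQPlus_nwd [Countable X] [T1Space X]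
    (hX : ∀ U : Set X, IsOpen U → U.Nonempty → U.Infinite) : IsQPlus (nwd τ) := by
  rintro A hA P hfin hdisj rfl
  obtain ⟨U, hUE, hUne, hU⟩ := exists_mem_basis_of_notMem_nwd hE hA
  obtain ⟨R, hR, hmeet⟩ := exists_partial_forall_meets (X := X)
    (ι := {V : E // V.1 ⊆ U ∧ V.1.Nonempty}) hκ ((mk_subtype_le _).trans hEκ)
    (fun V => {e | e.2 ∈ V.1.1 ∧ e.2 ∈ P e.1}) fun V k => by
      obtain ⟨x, hx, hxN⟩ := diff_nonempty_of_notMem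
        (inter_notMem_nwd hU (hE.isOpen V.1.2) V.2.1 V.2.2)
        (biUnion_lt_mem (fun n => finite_mem_nwd hX (hfin n)) k)
      obtain ⟨n, hn⟩ := Set.mem_iUnion.1 hx.1
      exact ⟨(n, x), ⟨hx.2, hn⟩, not_lt.1 fun hlt =>
        hxN (Set.mem_biUnion (show n ∈ {i | i < k} from hlt) hn)⟩
  refine ⟨⋃ n, R n ∩ P n, ?_, Set.iUnion_mono fun n => Set.inter_subset_right, fun n => ?_⟩
  · refine notMem_nwd_of_forall_inter_nonempty hE hUE hUne fun V hV hVU hne => ?_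
    obtain ⟨e, ⟨heV, heP⟩, heR⟩ := hmeet ⟨⟨V, hV⟩, hVU, hne⟩
    exact ⟨e.2, Set.mem_iUnion.2 ⟨e.1, heR, heP⟩, heV⟩
  · have hsub : (⋃ n, R n ∩ P n) ∩ P n ⊆ R n := by
      rintro x ⟨hx, hxn⟩
      obtain ⟨m, hxR, hxm⟩ := Set.mem_iUnion.1 hx
      have hmn : m = n := by
        by_contra hne
        exact Set.disjoint_left.1 (hdisj hne) hxm hxn
      exact hmn ▸ hxR
    exact (hR n).anti hsub

/-- Preimages of finitely many columns are nowhere dense, so the image of each `V` reaches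
arbitrarily far columns. One function `f` then meets all these images, and the preimage of its graph
is dense in `U`. -/
theorem not_ED_katetovLE_restrict_nwd {Y : Set X} (hY : Y ∉ nwd τ) :
    ¬ KatetovLE ED (restrict (nwd τ) Y) := by
  rintro ⟨g, hg⟩
  obtain ⟨U, hUE, hUne, hU⟩ := exists_mem_basis_of_notMem_nwd hE hY
  obtain ⟨f, hf⟩ := exists_forall_meets
    (ι := {V : E // V.1 ⊆ U ∧ V.1.Nonempty}) hκ ((mk_subtype_le _).trans hEκ)
    (fun V => g '' {y | y.1 ∈ V.1.1}) fun V k => by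
      have hcol : {e : ℕ × ℕ | e.1 < k} ∈ ED :=
        ⟨Finset.range k, ∅, Set.finite_empty, fun e he => Or.inl (Finset.mem_range.2 he)⟩
      obtain ⟨x, hx, hxN⟩ := diff_nonempty_of_notMem
        (inter_notMem_nwd hU (hE.isOpen V.1.2) V.2.1 V.2.2) (hg _ hcol)
      exact ⟨_, ⟨⟨x, hx.1⟩, hx.2, rfl⟩, not_lt.1 fun hlt => hxN ⟨⟨x, hx.1⟩, hlt, rfl⟩⟩
  have hgraph : {e : ℕ × ℕ | f e.1 = e.2} ∈ ED :=
    ⟨∅, {f}, Set.finite_singleton f, fun e he => Or.inr ⟨f, rfl, he⟩⟩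
  refine notMem_nwd_of_forall_inter_nonempty hE hUE hUne (fun V hV hVU hne => ?_) (hg _ hgraph)
  obtain ⟨_, ⟨y, hyV, rfl⟩, hfy⟩ := hf ⟨⟨V, hV⟩, hVU, hne⟩
  exact ⟨y, ⟨y, hfy, rfl⟩, hyV⟩

end Topology

/-- A tight ideal is not Katětov below `nwd`. -/
theorem IsTight.not_katetovLE_nwdRat {X : Type*} {I : Order.Ideal (Set X)} (hI : IsTight I) :
    ¬ KatetovLE I nwdRat := by
  rintro ⟨f, hf⟩
  obtain ⟨b, hbc, hbe, hb⟩ := TopologicalSpace.exists_countable_basis ℚ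
  have hbne : b.Nonempty := by
    obtain ⟨V, hV, -⟩ := hb.exists_subset_of_mem_open (Set.mem_univ (0 : ℚ)) isOpen_univ
    exact ⟨V, hV⟩
  obtain ⟨V, rfl⟩ := hbc.exists_eq_range hbne
  have hVne : ∀ n, (V n).Nonempty := fun n =>
    Set.nonempty_iff_ne_empty.2 fun h => hbe ⟨n, h⟩
  -- Each `f '' V n` is positive because its preimage contains the nonempty open set `V n`.
  obtain ⟨Y, hY, hinf⟩ := hI (fun n => f '' V n) fun n hn =>
    notMem_nwd_of_subset_closure (hb.isOpen ⟨n, rfl⟩) (hVne n)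
      ((Set.subset_preimage_image f (V n)).trans subset_closure) (hf _ hn)
  have hdense : Dense (f ⁻¹' Y) := hb.dense_iff.2 fun o ho _ => by
    obtain ⟨n, rfl⟩ := ho
    obtain ⟨_, hy, x, hx, rfl⟩ := (hinf n).nonempty
    exact ⟨x, hx, hy⟩
  exact notMem_nwd_of_subset_closure isOpen_univ Set.univ_nonempty
    (hdense.closure_eq ▸ subset_rfl) (hf Y hY)

end CategoryDichotomy

namespace CategoryDichotomy

/-! ## Spaces of independent families -/

theorem mem_side_iff {A : Set ℕ} {i : Fin 2} {n : ℕ} : n ∈ side A i ↔ (n ∈ A ↔ i = 0) := by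
  unfold side
  split_ifs with h <;> simp [h]

theorem cell_singleton (A : Set ℕ) : cell {A} (fun _ => 0) = A := by
  ext n
  simp [mem_cell, mem_side_iff]

theorem cell_congr {s : Finset (Set ℕ)} {p q : Set ℕ → Fin 2} (h : ∀ A ∈ s, p A = q A) :
    cell s p = cell s q := by
  ext n
  simp only [mem_cell]
  exact forall₂_congr fun A hA => by rw [h A hA]

theorem cell_inter_eq_cell_insert [DecidableEq (Set ℕ)] {s : Finset (Set ℕ)} {p : Set ℕ → Fin 2}
    {A : Set ℕ} (hA : A ∉ s) (i : Fin 2) :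
    cell s p ∩ side A i = cell (insert A s) (Function.update p A i) := by
  have h : cell s (Function.update p A i) = cell s p :=
    cell_congr fun C hC => Function.update_of_ne (ne_of_mem_of_not_mem hC hA) _ _
  ext n
  rw [← h]
  simp [mem_cell, and_comm]

/-- A cell is coded by two finite subsets of `B`: its support and the part of it where `p` is `0`.
-/
theorem mk_envelope_le {B : Set (Set ℕ)} (hB : B.Infinite) : #(envelope B) ≤ #B := by
  classical
  have : Infinite B := hB.to_subtype
  let c : Finset B × Finset B → Set ℕ := fun t =>
    cell (t.1.map (Function.Embedding.subtype _))
      fun A => if A ∈ t.2.map (Function.Embedding.subtype _) then 0 else 1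
  have hsub : envelope B ⊆ Set.range c := by
    rintro _ ⟨s, p, hs, rfl⟩
    have hmem : ∀ A ∈ s, A ∈ B := fun A hA => hs hA
    refine ⟨(s.subtype (· ∈ B), (s.filter (p · = 0)).subtype (· ∈ B)), ?_⟩
    have h1 : (s.subtype (· ∈ B)).map (Function.Embedding.subtype _) = s :=
      Finset.subtype_map_of_mem hmem
    have h2 : ((s.filter (p · = 0)).subtype (· ∈ B)).map (Function.Embedding.subtype _) =
        s.filter (p · = 0) :=
      Finset.subtype_map_of_mem fun A hA => hmem A (Finset.mem_filter.1 hA).1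
    show cell _ _ = _
    simp only [h1, h2]
    refine cell_congr fun A hA => ?_
    by_cases h : p A = 0
    · simp [hA, h]
    · simp only [Finset.mem_filter, hA, h, and_false, if_false]
      omega
  calc #(envelope B) ≤ #(Set.range c) := mk_le_mk_of_subset hsub
    _ ≤ #(Finset B × Finset B) := mk_range_le
    _ = #B := by
      rw [← mul_def, mk_finset_of_infinite, mul_eq_self (aleph0_le_mk B)]

theorem IsIndependentFamily.infinite_of_isOpen {B : Set (Set ℕ)} (hB : IsIndependentFamily B)
    {U : Set ℕ} (hU : @IsOpen ℕ (indepTopology B) U) (hne : U.Nonempty) : U.Infinite := by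
  let := indepTopology B
  obtain ⟨x, hx⟩ := hne
  obtain ⟨_, ⟨s, p, hs, rfl⟩, -, hsub⟩ :=
    (isTopologicalBasis_envelope B).exists_subset_of_mem_open hx hU
  exact (hB.2.2 s p hs).mono hsub

theorem SeparatesPoints.t1Space {B : Set (Set ℕ)} (hB : SeparatesPoints B) :
    @T1Space ℕ (indepTopology B) := by
  refine (@t1Space_iff_exists_open ℕ (indepTopology B)).2 fun m n hmn => ?_
  obtain ⟨A, hA, hm, hn⟩ := hB m n hmn
  exact ⟨A, TopologicalSpace.isOpen_generateFrom_of_mem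
    ⟨{A}, fun _ => 0, by simpa using hA, (cell_singleton A).symm⟩, hm, hn⟩

/-- A set whose points eventually lie in each of infinitely many members of an independent family
is nowhere dense. -/
theorem IsIndependentFamily.range_mem_nwd {B : Set (Set ℕ)} (hB : IsIndependentFamily B)
    (hsep : SeparatesPoints B) {C : ℕ → Set ℕ} (hCB : ∀ i, C i ∈ B)
    (hCinj : Function.Injective C) {y : ℕ → ℕ} (hy : ∀ i k, i ≤ k → y k ∈ C i) :
    Set.range y ∈ nwd (indepTopology B) := by
  classical
  let := indepTopology B
  have := hsep.t1Space
  by_contra hY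
  obtain ⟨_, ⟨s, p, hs, rfl⟩, -, hU⟩ :=
    exists_mem_basis_of_notMem_nwd (isTopologicalBasis_envelope B) hY
  obtain ⟨i, hi⟩ : ∃ i, C i ∉ s := by
    by_contra! hall
    exact Set.infinite_range_of_injective hCinj
      (s.finite_toSet.subset (Set.range_subset_iff.2 hall))
  -- Inside the cell where the range is dense, the part off `C i` contains only points `y k` with `k
  -- < i`; but the range must be positive there, while finite sets are not.
  set W := cell (insert (C i) s) (Function.update p (C i) 1) with hW
  have hsub : ((insert (C i) s : Finset (Set ℕ)) : Set (Set ℕ)) ⊆ B := by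
    rw [Finset.coe_insert]
    exact Set.insert_subset (hCB i) hs
  have hWopen : IsOpen W := TopologicalSpace.isOpen_generateFrom_of_mem ⟨_, _, hsub, rfl⟩
  have hWeq : cell s p ∩ side (C i) 1 = W := cell_inter_eq_cell_insert hi 1
  have hfin : Set.range y ∩ W ⊆ y '' Set.Iio i := by
    rintro _ ⟨⟨k, rfl⟩, hk⟩
    refine ⟨k, Set.mem_Iio.2 (not_le.1 fun hik => ?_), rfl⟩
    have h := mem_side_iff.1 (hWeq ▸ hk : y k ∈ cell s p ∩ side (C i) 1).2
    exact absurd (h.1 (hy i k hik)) one_ne_zero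
  exact inter_notMem_nwd hU hWopen (hWeq ▸ Set.inter_subset_left)
    (hB.2.2 _ _ hsub).nonempty (finite_mem_nwd (fun U => hB.infinite_of_isOpen)
      (((Set.finite_Iio i).image y).subset hfin))

theorem isTight_nwd_indepTopology {B : Set (Set ℕ)} (hB : IsIndependentFamily B)
    (hsep : SeparatesPoints B) (hunc : ¬ B.Countable) : IsTight (nwd (indepTopology B)) := by
  classical
  let := indepTopology B
  have := hsep.t1Space
  intro S hS
  choose U hU _ hUS using fun n =>
    exists_mem_basis_of_notMem_nwd (isTopologicalBasis_envelope B) (hS n)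
  choose s p hs hUeq using hU
  have hinf : (B \ ⋃ n, (s n : Set (Set ℕ))).Infinite := fun hfin => hunc <| by
    refine (hfin.countable.union (Set.countable_iUnion fun n => (s n).countable_toSet)).mono ?_
    intro A hA
    by_cases h : A ∈ ⋃ n, (s n : Set (Set ℕ))
    · exact Or.inr h
    · exact Or.inl ⟨hA, h⟩
  let C : ℕ → Set ℕ := fun i => hinf.natEmbedding _ i
  have hCinj : Function.Injective C := Subtype.val_injective.comp (hinf.natEmbedding _).injective
  have hCB : ∀ i, C i ∈ B := fun i => (hinf.natEmbedding _ i).2.1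
  have hCs : ∀ i n, C i ∉ s n := fun i n h =>
    (hinf.natEmbedding _ i).2.2 (Set.mem_iUnion.2 ⟨n, h⟩)
  -- Since the `C i` avoid the support `s n`, intersecting the cell `U n` with `C 0, …, C k` leaves
  -- a nonempty basic set, in which `S n` is still positive.
  have key : ∀ n k, ∃ y ∈ S n, k ≤ y ∧ ∀ i ≤ k, y ∈ C i := fun n k => by
    let t := s n ∪ (Finset.range (k + 1)).image C
    let q : Set ℕ → Fin 2 := fun A => if A ∈ s n then p n A else 0
    have ht : (t : Set (Set ℕ)) ⊆ B := by
      intro A hA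
      rcases Finset.mem_union.1 hA with h | h
      · exact hs n h
      · obtain ⟨i, -, rfl⟩ := Finset.mem_image.1 h
        exact hCB i
    have hsubU : cell t q ⊆ U n := by
      rw [hUeq]
      intro x hx
      refine mem_cell.2 fun A hA => ?_
      simpa [q, hA] using mem_cell.1 hx A (Finset.mem_union_left _ hA)
    have hpos : S n ∩ cell t q ∉ nwd (indepTopology B) := inter_notMem_nwd (hUS n)
      (TopologicalSpace.isOpen_generateFrom_of_mem ⟨t, q, ht, rfl⟩) hsubU
      (hB.2.2 t q ht).nonempty
    obtain ⟨y, hy, hyk⟩ := diff_nonempty_of_notMem hpos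
      (finite_mem_nwd (fun U => hB.infinite_of_isOpen) (Set.finite_Iio k))
    refine ⟨y, hy.1, not_lt.1 hyk, fun i hi => ?_⟩
    have h := mem_cell.1 hy.2 (C i) (Finset.mem_union_right _
      (Finset.mem_image_of_mem _ (Finset.mem_range.2 (Nat.lt_succ_of_le hi))))
    exact (mem_side_iff.1 h).2 (by simp [q, hCs i n])
  choose y hyS hyk hyC using key
  -- Unpairing returns to each `S n` infinitely often, and `k ≤ y n k` makes the chosen points
  -- unbounded.
  refine ⟨Set.range fun k => y k.unpair.1 k,
    hB.range_mem_nwd hsep hCB hCinj fun i k hik => hyC _ _ _ hik,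
    fun n => Set.infinite_of_forall_exists_gt fun a => ?_⟩
  have ha : a + 1 ≤ Nat.pair n (a + 1) := Nat.right_le_pair _ _
  refine ⟨_, ⟨⟨Nat.pair n (a + 1), rfl⟩, ?_⟩, ha.trans (hyk _ _)⟩
  simpa using hyS n (Nat.pair n (a + 1))

/-! ## A separating independent family of size `ℵ₁` -/

/-- A fresh member of `B` splits any cell into two smaller cells; by induction one has at least `k`
points, and the other adds one more. -/
theorem isIndependentFamily_of_cell_nonempty {B : Set (Set ℕ)} (hB : B.Infinite)
    (h : ∀ (s : Finset (Set ℕ)) (p : Set ℕ → Fin 2), (s : Set (Set ℕ)) ⊆ B → (cell s p).Nonempty) :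
    IsIndependentFamily B := by
  classical
  have hcard : ∀ (k : ℕ) (s : Finset (Set ℕ)) (p : Set ℕ → Fin 2), (s : Set (Set ℕ)) ⊆ B →
      (k : ℕ∞) ≤ (cell s p).encard := by
    intro k
    induction k with
    | zero => simp
    | succ k ih =>
      intro s p hs
      obtain ⟨A, hA, hAs⟩ := hB.exists_notMem_finset s
      have hsub : ((insert A s : Finset (Set ℕ)) : Set (Set ℕ)) ⊆ B := by
        rw [Finset.coe_insert]
        exact Set.insert_subset hA hs
      have hdisj : Disjoint (cell s p ∩ side A 0) (cell s p ∩ side A 1) := by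
        refine Set.disjoint_left.2 fun n h0 h1 => ?_
        exact one_ne_zero ((mem_side_iff.1 h1.2).1 ((mem_side_iff.1 h0.2).2 rfl))
      have hle := Set.encard_le_encard
        (Set.union_subset (Set.inter_subset_left (s := cell s p) (t := side A 0))
          (Set.inter_subset_left (s := cell s p) (t := side A 1)))
      rw [Set.encard_union_eq hdisj] at hle
      refine le_trans ?_ hle
      rw [Nat.cast_add, Nat.cast_one]
      refine add_le_add ?_ (Set.one_le_encard_iff_nonempty.2 ?_)
      · rw [cell_inter_eq_cell_insert hAs]
        exact ih _ _ hsub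
      · rw [cell_inter_eq_cell_insert hAs]
        exact h _ _ hsub
  have hinf : ∀ (s : Finset (Set ℕ)) (p : Set ℕ → Fin 2), (s : Set (Set ℕ)) ⊆ B →
      (cell s p).Infinite := fun s p hs => by
    rw [← Set.encard_eq_top_iff]
    exact ENat.eq_top_iff_forall_ge.2 fun k => hcard k s p hs
  refine ⟨hB, fun A hA => ?_, hinf⟩
  rw [← cell_singleton A]
  exact hinf _ _ (by simpa using hA)

/-- The points of the Cantor space that are eventually equal to `b`. -/
def eventuallyConst (b : Bool) : Set (ℕ → Bool) :=
  Set.range fun F : Finset ℕ => fun n => if n ∈ F then !b else b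

theorem countable_eventuallyConst (b : Bool) : (eventuallyConst b).Countable :=
  Set.countable_range _

theorem dense_eventuallyConst (b : Bool) : Dense (eventuallyConst b) := fun x => by
  refine mem_closure_of_tendsto (b := Filter.atTop)
    (f := fun k n => if n ∈ (Finset.range k).filter (fun m => x m = !b) then !b else b)
    (tendsto_pi_nhds.2 fun n => tendsto_const_nhds.congr' ?_)
    (Filter.Eventually.of_forall fun k => ⟨_, rfl⟩)
  filter_upwards [Filter.eventually_gt_atTop n] with k hn
  cases b <;> cases h : x n <;> simp [h, hn]

theorem disjoint_eventuallyConst : Disjoint (eventuallyConst true) (eventuallyConst false) := by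
  classical
  refine Set.disjoint_left.2 ?_
  rintro _ ⟨F, rfl⟩ ⟨G, hG⟩
  obtain ⟨n, hn⟩ := Infinite.exists_notMem_finset (F ∪ G)
  have h := congrFun hG n
  simp only [Finset.mem_union, not_or] at hn
  simp [hn] at h

theorem exists_set_cantor_mk_eq_aleph_one : ∃ R : Set (ℕ → Bool), #R = ℵ₁ ∧
    eventuallyConst true ⊆ R ∧ eventuallyConst false ⊆ R := by
  have hK : ℵ₁ ≤ #(ℕ → Bool) := by simpa using aleph_one_le_continuum
  obtain ⟨S, hS⟩ := le_mk_iff_exists_set.1 hK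
  refine ⟨S ∪ (eventuallyConst true ∪ eventuallyConst false), le_antisymm ?_ ?_,
    Set.subset_union_left.trans Set.subset_union_right,
    Set.subset_union_right.trans Set.subset_union_right⟩
  · refine (mk_union_le _ _).trans ?_
    have hc := ((countable_eventuallyConst true).union (countable_eventuallyConst false)).le_aleph0
    rw [hS]
    exact add_le_of_le aleph0_lt_aleph_one.le le_rfl (hc.trans aleph0_lt_aleph_one.le)
  · rw [← hS]
    exact mk_le_mk_of_subset Set.subset_union_left

/-- A point `x` of the Cantor space gives the set of codes of clopen sets containing `x`,
complemented when `x` is eventually `true`. Independence holds because clopen sets separate disjoint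
finite sets. The complementing serves separation: when `c m` is properly contained in `c n`, only a
complemented set contains `m` and omits `n`. -/
theorem exists_separating_isIndependentFamily :
    ∃ B : Set (Set ℕ), IsIndependentFamily B ∧ SeparatesPoints B ∧ #B = ℵ₁ := by
  classical
  have : Countable (TopologicalSpace.Clopens (ℕ → Bool)) :=
    TopologicalSpace.Clopens.countable_iff_secondCountable.2 inferInstance
  have : Infinite (TopologicalSpace.Clopens (ℕ → Bool)) := by
    refine Infinite.of_injective (fun n : ℕ => (⟨{x | x n = true},
      (isClopen_discrete {true}).preimage (continuous_apply (A := fun _ : ℕ => Bool) n)⟩ :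
        TopologicalSpace.Clopens (ℕ → Bool))) fun m n hmn => ?_
    have h : ({x : ℕ → Bool | x m = true} : Set (ℕ → Bool)) = {x | x n = true} :=
      congrArg TopologicalSpace.Clopens.carrier hmn
    have hx : (fun k => decide (k = m)) ∈ {x : ℕ → Bool | x m = true} := by simp
    rw [h] at hx
    exact (by simpa using hx : n = m).symm
  obtain ⟨c⟩ : Nonempty (ℕ ≃ TopologicalSpace.Clopens (ℕ → Bool)) :=
    nonempty_equiv_of_countable
  obtain ⟨R, hR, hRt, hRf⟩ := exists_set_cantor_mk_eq_aleph_one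
  let F : (ℕ → Bool) → Set ℕ := fun x => {n | x ∈ c n ↔ x ∉ eventuallyConst true}
  have hF : ∀ x n, n ∈ F x ↔ (x ∈ c n ↔ x ∉ eventuallyConst true) := fun x n => Iff.rfl
  have hinj : Function.Injective F := fun x y hxy => by
    by_contra hne
    obtain ⟨U, hU, hxU, hyU⟩ := exists_isClopen_of_totally_separated hne
    have h1 : c.symm ⟨U, hU⟩ ∈ F x ↔ c.symm ⟨U, hU⟩ ∈ F y := by rw [hxy]
    -- The code of the whole space reveals whether `F x` is complemented; then `U` distinguishes `x`
    -- from `y`.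
    have h2 : c.symm ⊤ ∈ F x ↔ c.symm ⊤ ∈ F y := by rw [hxy]
    have hx : x ∈ (⟨U, hU⟩ : TopologicalSpace.Clopens (ℕ → Bool)) := hxU
    have hy : y ∉ (⟨U, hU⟩ : TopologicalSpace.Clopens (ℕ → Bool)) := hyU
    have hx' : x ∈ (⊤ : TopologicalSpace.Clopens (ℕ → Bool)) := trivial
    have hy' : y ∈ (⊤ : TopologicalSpace.Clopens (ℕ → Bool)) := trivial
    simp only [hF, Equiv.apply_symm_apply] at h1 h2
    tauto
  have hcard : #(F '' R) = ℵ₁ := (mk_image_eq hinj).trans hR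
  have hBinf : (F '' R).Infinite := by
    rw [← Set.infinite_coe_iff, infinite_iff, hcard]
    exact aleph0_lt_aleph_one.le
  refine ⟨F '' R, isIndependentFamily_of_cell_nonempty hBinf fun s p hs => ?_, ?_, hcard⟩
  · have hs' : ∀ A ∈ s, ∃ x, F x = A := fun A hA => (hs hA).imp fun x hx => hx.2
    choose! g hg using hs'
    -- The points that the clopen set must contain, with the complementing taken into account.
    let want : Set ℕ → Prop := fun A => (g A ∉ eventuallyConst true ↔ p A = 0)
    obtain ⟨U, hU, hPU, hUN⟩ := exists_clopen_of_closed_subset_open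
      (Z := g '' {A | A ∈ s ∧ want A}) (U := (g '' {A | A ∈ s ∧ ¬ want A})ᶜ)
      ((s.finite_toSet.subset fun A hA => hA.1).image g).isClosed
      ((s.finite_toSet.subset fun A hA => hA.1).image g).isClosed.isOpen_compl (by
        rintro _ ⟨A, hA, rfl⟩ ⟨A', hA', hAA'⟩
        have : A' = A := by rw [← hg A' hA'.1, ← hg A hA.1, hAA']
        exact hA'.2 (this ▸ hA.2))
    refine ⟨c.symm ⟨U, hU⟩, mem_cell.2 fun A hA => mem_side_iff.2 ?_⟩
    have hmem : g A ∈ (⟨U, hU⟩ : TopologicalSpace.Clopens (ℕ → Bool)) ↔ want A :=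
      ⟨fun h => by_contra fun hw => hUN h ⟨A, ⟨hA, hw⟩, rfl⟩, fun hw => hPU ⟨A, ⟨hA, hw⟩, rfl⟩⟩
    have h1 : c.symm ⟨U, hU⟩ ∈ F (g A) ↔ p A = 0 := by
      rw [hF, Equiv.apply_symm_apply, hmem]
      simp only [want]
      tauto
    rwa [hg A hA] at h1
  · have key : ∀ m n x, x ∈ c m → x ∉ c n → ∃ y ∈ eventuallyConst true,
        ∃ z ∈ eventuallyConst false, (y ∈ c m ∧ y ∉ c n) ∧ z ∈ c m ∧ z ∉ c n := by
      intro m n x hm hn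
      have hopen : IsOpen ((c m : Set (ℕ → Bool)) ∩ (c n : Set (ℕ → Bool))ᶜ) :=
        (c m).isClopen.isOpen.inter (c n).isClopen.compl.isOpen
      obtain ⟨y, hy, hyt⟩ := (dense_eventuallyConst true).inter_open_nonempty _ hopen ⟨x, hm, hn⟩
      obtain ⟨z, hz, hzf⟩ := (dense_eventuallyConst false).inter_open_nonempty _ hopen ⟨x, hm, hn⟩
      exact ⟨y, hyt, z, hzf, hy, hz⟩
    intro m n hmn
    have hne : ∃ x, ¬ (x ∈ c m ↔ x ∈ c n) := by
      by_contra! h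
      exact hmn (c.injective (SetLike.ext h))
    obtain ⟨x, hx⟩ := hne
    by_cases hm : x ∈ c m
    · obtain ⟨-, -, z, hz, -, hzm, hzn⟩ := key m n x hm (by tauto)
      have hzt := Set.disjoint_right.1 disjoint_eventuallyConst hz
      refine ⟨F z, ⟨z, hRf hz, rfl⟩, ?_⟩
      rw [hF, hF]
      tauto
    · obtain ⟨y, hy, -, -, ⟨hyn, hym⟩, -⟩ := key n m x (by tauto) hm
      refine ⟨F y, ⟨y, hRt hy, rfl⟩, ?_⟩
      rw [hF, hF]
      tauto

end CategoryDichotomy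
-- Failure of the Category Dichotomy for `nwd(X(B))`
theorem mainTheorem6 (h : ℵ₁ < CategoryDichotomy.covM) :
    (∃ B : Set (Set ℕ), CategoryDichotomy.IsIndependentFamily B ∧
      CategoryDichotomy.SeparatesPoints B ∧ #B = ℵ₁ ∧
      ¬ CategoryDichotomy.SatisfiesCategoryDichotomy
          (CategoryDichotomy.nwd (CategoryDichotomy.indepTopology B))) ∧
    ∀ B : Set (Set ℕ), CategoryDichotomy.IsIndependentFamily B →
      CategoryDichotomy.SeparatesPoints B → #B = ℵ₁ →
      CategoryDichotomy.IsTight (CategoryDichotomy.nwd (CategoryDichotomy.indepTopology B)) ∧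
      ¬ CategoryDichotomy.KatetovLE
          (CategoryDichotomy.nwd (CategoryDichotomy.indepTopology B)) CategoryDichotomy.nwdRat ∧
      CategoryDichotomy.IsPMinus (CategoryDichotomy.nwd (CategoryDichotomy.indepTopology B)) ∧
      CategoryDichotomy.IsQPlus (CategoryDichotomy.nwd (CategoryDichotomy.indepTopology B)) ∧
      ∀ Y : Set ℕ, Y ∉ CategoryDichotomy.nwd (CategoryDichotomy.indepTopology B) →
        ¬ CategoryDichotomy.KatetovLE CategoryDichotomy.ED
            (CategoryDichotomy.restrict
              (CategoryDichotomy.nwd (CategoryDichotomy.indepTopology B)) Y) := by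
  have hgen : ∀ B : Set (Set ℕ), CategoryDichotomy.IsIndependentFamily B →
      CategoryDichotomy.SeparatesPoints B → #B = ℵ₁ →
      CategoryDichotomy.IsTight (CategoryDichotomy.nwd (CategoryDichotomy.indepTopology B)) ∧
      ¬ CategoryDichotomy.KatetovLE
          (CategoryDichotomy.nwd (CategoryDichotomy.indepTopology B)) CategoryDichotomy.nwdRat ∧
      CategoryDichotomy.IsPMinus (CategoryDichotomy.nwd (CategoryDichotomy.indepTopology B)) ∧
      CategoryDichotomy.IsQPlus (CategoryDichotomy.nwd (CategoryDichotomy.indepTopology B)) ∧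
      ∀ Y : Set ℕ, Y ∉ CategoryDichotomy.nwd (CategoryDichotomy.indepTopology B) →
        ¬ CategoryDichotomy.KatetovLE CategoryDichotomy.ED
            (CategoryDichotomy.restrict
              (CategoryDichotomy.nwd (CategoryDichotomy.indepTopology B)) Y) := by
    intro B hB hsep hcard
    let := CategoryDichotomy.indepTopology B
    have := hsep.t1Space
    have hbase := CategoryDichotomy.isTopologicalBasis_envelope B
    have hE : #(CategoryDichotomy.envelope B) ≤ ℵ₁ :=
      hcard ▸ CategoryDichotomy.mk_envelope_le hB.1
    have hunc : ¬ B.Countable := fun hc => by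
      have hle := hc.le_aleph0
      rw [hcard] at hle
      exact hle.not_gt aleph0_lt_aleph_one
    have htight := CategoryDichotomy.isTight_nwd_indepTopology hB hsep hunc
    exact ⟨htight, htight.not_katetovLE_nwdRat, CategoryDichotomy.isPMinus_nwd hbase h hE,
      CategoryDichotomy.isQPlus_nwd hbase h hE fun U => hB.infinite_of_isOpen,
      fun Y hY => CategoryDichotomy.not_ED_katetovLE_restrict_nwd hbase h hE hY⟩
  obtain ⟨B, hB, hsep, hcard⟩ := CategoryDichotomy.exists_separating_isIndependentFamily
  obtain ⟨-, hnle, -, -, hED⟩ := hgen B hB hsep hcard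
  refine ⟨⟨B, hB, hsep, hcard, ?_⟩, hgen⟩
  rintro (hle | ⟨Y, hY, hle⟩)
  · exact hnle hle
  · exact hED Y hY hle
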